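/- **Objects and semantics.** A concurrent object provides methods executed by $n$ processes $P_1,\dots,P_n$ on a shared memory. $\llbracket \mathcal O,n\rrbracket$ denotes the labelled transition system of $n$ processes that each repeatedly call an arbitrary method of $\mathcal O$ with an arbitrary argument, arbitrarily often (the most general client); its labels are call actions $\mathrm{call}(P_i,m,a)$, return actions $\mathrm{return}(P_i,m,b)$ and internal actions, and steps of different processes interleave arbitrarily. For two such systems, $A_1\preceq_{(c,r)}A_2$ means that there is a relation $R$ between configurations of $A_1$ and of $A_2$ that relates the initial configurations and is such that, whenever $(c_1,c_2)\in R$ and $c_1\xrightarrow{\alpha}c_1'$ in $A_1$, there are a finite sequence of labels $l$ and a configuration $c_2'$ with $c_2\xrightarrow{l}c_2'$ in $A_2$ and $(c_1',c_2')\in R$, and $\alpha$ and $l$ have the same projection to call and return actions. **The Herlihy–Wing queue $\mathcal O_{HWQ}$** has an unbounded array $Q$, initially $\bot$ everywhere, and a variable $X$, initially $1$. Each of the following labelled lines is one atomic step. - $enq(v)$, $v\in\mathbb N$: $E_1$: $i:=getAndInc(X)$; $E_2$: $Q[i]:=v$; $E_3$: return $ack$. - $deq()$: $D_1$: $l:=X$;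 $D_2$: if $l=1$ go to $D_1$, else $j:=1$; $D_3$: $x:=swap(Q[j],\bot)$; if $x\neq\bot$ go to $D_4$; otherwise, if $j=l-1$ go to $D_1$, else $j:=j+1$ and go to $D_3$; $D_4$: return $x$. **The time-stamped queue $\mathcal O_{TSQ}$** has, for each process, a pool (a list of nodes in order of insertion, initially empty), and an integer counter from which timestamps are drawn by an atomic get-and-increment, $newTimestamp()$. A timestamp is an integer or $\top$, where $\top$ is larger than every integer. Each pool operation and each draw of a timestamp is atomic. - $enq(v)$ by $P_i$: insert a new node with value $v$ and timestamp $\top$ at the back of the pool of $P_i$; $t:=newTimestamp()$; set the timestamp of the node to $t$; return $ack$. - $deq()$: repeat the following round. Set $startTs:=newTimestamp()$. Scan all the pools once each, in an arbitrary order in which every next pool is chosen nondeterministically; in each, read the oldest node (if any) and make it the candidate if its timestamp, as read, is smaller than $startTs$ and than the timestamp of the current candidate (if any). After the scan, if there is a candidate, try to remove it from its pool. If the removal succeeds, return its value; if there is no candidate or the node is no longer in its pool, start a new round. **Theorem.** For every number $n$ of processes, the Herlihy–Wing queue is forward-simulated by the time-stamped queue: $$\llbracket \mathcal O_{HWQ},n\rrbracket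 \preceq_{(c,r)} \llbracket \mathcal O_{TSQ},n\rrbracket .$$ -/

import Mathlib

namespace ConcObj

/-! ### Labelled transition systems and forward simulation -/

/-- A labelled transition system over the alphabet `L`. -/
structure LTS (L : Type) where
  State : Type
  init : State
  Tr : State → L → State → Prop

/-- `A.Path q l q'`: the state `q'` is reachable from `q` by the finite sequence `l` of transitions. -/
inductive LTS.Path {L : Type} (A : LTS L) : A.State → List L → A.State → Prop
  | nil (q : A.State) : LTS.Path A q [] q
  | cons {q q' q'' : A.State} {a : L} {l : List L} :
      A.Tr q a q' → LTS.Path A q' l q'' → LTS.Path A q (a :: l) q''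

/-- The signature of a concurrent object: its methods, and for every method the type of its
argument and the type of its return value. -/
structure Signature where
  Meth : Type
  Arg : Meth → Type
  Ret : Meth → Type

/-- Transition labels of a system of `n` processes: call actions, return actions and
internal actions of a process. -/
inductive Action (S : Signature) (n : ℕ) : Type
  | call (i : Fin n) (m : S.Meth) (a : S.Arg m)
  | ret (i : Fin n) (m : S.Meth) (b : S.Ret m)
  | internal (i : Fin n)

/-- Only call and return actions are visible. -/
def Action.visible {S : Signature} {n : ℕ} : Action S n → Bool
  | .call _ _ _ => true
  | .ret _ _ _ => true
  | .internal _ => false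

/-- The projection of a sequence of labels to its call and return actions. -/
def history {S : Signature} {n : ℕ} (l : List (Action S n)) : List (Action S n) :=
  l.filter Action.visible

/-- `R` is a forward simulation relation from `A` to `B` in which call and return actions are
visible and all other actions are internal. -/
structure IsForwardSimulation {S : Signature} {n : ℕ} (A B : LTS (Action S n))
    (R : A.State → B.State → Prop) : Prop where
  init : R A.init B.init
  step : ∀ (c₁ : A.State) (c₂ : B.State) (a : Action S n) (d₁ : A.State),
    R c₁ c₂ → A.Tr c₁ a d₁ →
      ∃ (l : List (Action S n)) (d₂ : B.State),
        B.Path c₂ l d₂ ∧ history l = history [a] ∧ R d₁ d₂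

/-- `A` is forward-simulated by `B`, with visible call and return actions. -/
def ForwardSimulated {S : Signature} {n : ℕ} (A B : LTS (Action S n)) : Prop :=
  ∃ R : A.State → B.State → Prop, IsForwardSimulation A B R

/-! ### Concurrent objects and their operational semantics -/

/-- A concurrent object with signature `S`. For every number `n` of processes it has a shared
memory, and for every method local states (program counter and registers) of a process that
executes this method. `step i m` are the atomic commands of method `m` executed by process `i`;
`result s b` says that in local state `s` the method is about to return the value `b`. -/
structure ConcurrentObject (S : Signature) where
  Mem : ℕ → Type
  Loc : ℕ → S.Meth → Type
  mem₀ : (n : ℕ) → Mem n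
  start : (n : ℕ) → (m : S.Meth) → S.Arg m → Loc n m
  step : (n : ℕ) → Fin n → (m : S.Meth) → Mem n → Loc n m → Mem n → Loc n m → Prop
  result : (n : ℕ) → (m : S.Meth) → Loc n m → S.Ret m → Prop

/-- Configurations of `n` processes: the shared memory, and for every process either `none`
(no method is being executed) or the method being executed together with its local state. -/
structure Config {S : Signature} (O : ConcurrentObject S) (n : ℕ) where
  mem : O.Mem n
  proc : Fin n → Option ((m : S.Meth) × O.Loc n m)

/-- Transitions of `n` processes, each of which runs the most general client of `O`: it calls
arbitrary methods with arbitrary arguments, one after the other, arbitrarily often. -/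
inductive Config.Step {S : Signature} (O : ConcurrentObject S) (n : ℕ) :
    Config O n → Action S n → Config O n → Prop
  | call (c : Config O n) (i : Fin n) (m : S.Meth) (a : S.Arg m) :
      c.proc i = none →
      Config.Step O n c (.call i m a)
        ⟨c.mem, Function.update c.proc i (some ⟨m, O.start n m a⟩)⟩
  | internal (c : Config O n) (i : Fin n) (m : S.Meth) (s s' : O.Loc n m) (mem' : O.Mem n) :
      c.proc i = some ⟨m, s⟩ → O.step n i m c.mem s mem' s' →
      Config.Step O n c (.internal i)
        ⟨mem', Function.update c.proc i (some ⟨m, s'⟩)⟩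
  | ret (c : Config O n) (i : Fin n) (m : S.Meth) (s : O.Loc n m) (b : S.Ret m) :
      c.proc i = some ⟨m, s⟩ → O.result n m s b →
      Config.Step O n c (.ret i m b) ⟨c.mem, Function.update c.proc i none⟩

/-- The operational semantics of the object `O` with `n` processes. -/
def sem {S : Signature} (O : ConcurrentObject S) (n : ℕ) : LTS (Action S n) where
  State := Config O n
  init := ⟨O.mem₀ n, fun _ => none⟩
  Tr := Config.Step O n

/-! ### The signature of queues -/

inductive QMeth : Type
  | enq
  | deq

/-- `enq` takes a natural number and returns an acknowledgement; `deq` takes no argument and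
returns a natural number. -/
def queueSig : Signature where
  Meth := QMeth
  Arg
    | .enq => ℕ
    | .deq => Unit
  Ret
    | .enq => Unit
    | .deq => ℕ

/-! ### The Herlihy-Wing queue -/

namespace HWQ

/-- Shared memory: the unbounded array `Q` (indices start at `1`; `none` is the value `⊥`) and the
next available index `X`. -/
structure Mem where
  Q : ℕ → Option ℕ
  X : ℕ

/-- Local states of `enq`, one constructor for each line of
`E1: i := getAndInc(X); E2: Q[i] := v; E3: return ack`. -/
inductive EnqLoc : Type
  | e1 (v : ℕ)
  | e2 (v i : ℕ)
  | e3

/-- Local states of `deq`, one constructor for each line of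
`D1: l := X;`
`D2: if l = 1 then go to D1, else j := 1;`
`D3: x := swap(Q[j], ⊥); if x ≠ ⊥ then go to D4;`
`otherwise, if j = l - 1 then go to D1, else j := j + 1 and go to D3;`
`D4: return x`. -/
inductive DeqLoc : Type
  | d1
  | d2 (l : ℕ)
  | d3 (l j : ℕ)
  | d4 (x : ℕ)

inductive EnqStep : Mem → EnqLoc → Mem → EnqLoc → Prop
  | e1 (σ : Mem) (v : ℕ) :
      EnqStep σ (.e1 v) { σ with X := σ.X + 1 } (.e2 v σ.X)
  | e2 (σ : Mem) (v i : ℕ) :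
      EnqStep σ (.e2 v i) { σ with Q := Function.update σ.Q i (some v) } .e3

inductive DeqStep : Mem → DeqLoc → Mem → DeqLoc → Prop
  | d1 (σ : Mem) :
      DeqStep σ .d1 σ (.d2 σ.X)
  | d2_back (σ : Mem) (l : ℕ) : l = 1 →
      DeqStep σ (.d2 l) σ .d1
  | d2_scan (σ : Mem) (l : ℕ) : l ≠ 1 →
      DeqStep σ (.d2 l) σ (.d3 l 1)
  | d3_found (σ : Mem) (l j x : ℕ) : σ.Q j = some x →
      DeqStep σ (.d3 l j) { σ with Q := Function.update σ.Q j none } (.d4 x)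
  | d3_back (σ : Mem) (l j : ℕ) : σ.Q j = none → j + 1 = l →
      DeqStep σ (.d3 l j) σ .d1
  | d3_next (σ : Mem) (l j : ℕ) : σ.Q j = none → j + 1 ≠ l →
      DeqStep σ (.d3 l j) σ (.d3 l (j + 1))

end HWQ

/-- The Herlihy-Wing queue. -/
def hwq : ConcurrentObject queueSig where
  Mem _ := HWQ.Mem
  Loc _
    | .enq => HWQ.EnqLoc
    | .deq => HWQ.DeqLoc
  mem₀ _ := ⟨fun _ => none, 1⟩
  start _
    | .enq => fun v => HWQ.EnqLoc.e1 v
    | .deq => fun _ => HWQ.DeqLoc.d1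
  step _ _
    | .enq => HWQ.EnqStep
    | .deq => HWQ.DeqStep
  result _
    | .enq => fun s _ => s = HWQ.EnqLoc.e3
    | .deq => fun s x => s = HWQ.DeqLoc.d4 x

/-! ### The time-stamped queue -/

namespace TSQ

/-- Timestamps are integers or `⊤`, which is larger than every integer. -/
abbrev Timestamp : Type := WithTop ℤ

/-- A pool node: a unique identifier, the stored value and the current timestamp. -/
structure Node where
  id : ℕ
  val : ℕ
  ts : Timestamp

/-- Shared memory: one pool for each process (a list, from the oldest node to the newest one), the
counter from which timestamps are drawn, and the next unused node identifier. -/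
structure Mem (n : ℕ) where
  pool : Fin n → List Node
  clock : ℤ
  fresh : ℕ

/-- Insertion of the value `v` at the back of the pool of process `i`, with timestamp `⊤`;
the identifier of the new node is `σ.fresh`. -/
def Mem.insert {n : ℕ} (σ : Mem n) (i : Fin n) (v : ℕ) : Mem n :=
  { σ with
    pool := Function.update σ.pool i (σ.pool i ++ [⟨σ.fresh, v, ⊤⟩])
    fresh := σ.fresh + 1 }

/-- Atomic increment of the clock; the generated timestamp is the old value `σ.clock`. -/
def Mem.tick {n : ℕ} (σ : Mem n) : Mem n :=
  { σ with clock := σ.clock + 1 }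

/-- The timestamp `t` is attached to the node `p` of the pool of process `i`. -/
def Mem.setTimestamp {n : ℕ} (σ : Mem n) (i : Fin n) (p : ℕ) (t : Timestamp) : Mem n :=
  { σ with
    pool := Function.update σ.pool i
      ((σ.pool i).map fun nd => if nd.id = p then { nd with ts := t } else nd) }

/-- The identifier and the timestamp of the oldest node of the pool of process `k`, if any. -/
def Mem.getOldest {n : ℕ} (σ : Mem n) (k : Fin n) : Option (ℕ × Timestamp) :=
  (σ.pool k).head?.map fun nd => (nd.id, nd.ts)

/-- The value of the node `p` in the pool of process `k`, or `none` if it is no longer there. -/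
def Mem.valueOf {n : ℕ} (σ : Mem n) (k : Fin n) (p : ℕ) : Option ℕ :=
  ((σ.pool k).find? fun nd => nd.id = p).map Node.val

/-- Removal of the node `p` from the pool of process `k` (no effect if it is not there). -/
def Mem.remove {n : ℕ} (σ : Mem n) (k : Fin n) (p : ℕ) : Mem n :=
  { σ with
    pool := Function.update σ.pool k ((σ.pool k).filter fun nd => nd.id ≠ p) }

/-- Local states of `enq`, one constructor for each line of
`N1: p := insert(myPool, v, ⊤); N2: t := newTimestamp();`
`N3: setTimestamp(myPool, p, t); N4: return ack`. -/
inductive EnqLoc : Type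
  | n1 (v : ℕ)
  | n2 (p : ℕ)
  | n3 (p : ℕ) (t : ℤ)
  | n4

/-- The candidate of a `deq`: the pool, the identifier and the timestamp of a node. -/
structure Cand (n : ℕ) where
  pool : Fin n
  id : ℕ
  ts : Timestamp

/-- The timestamp of the candidate, which is `⊤` if there is no candidate yet. -/
def candTs {n : ℕ} : Option (Cand n) → Timestamp
  | none => ⊤
  | some c => c.ts

/-- Local states of `deq`, one constructor for each line of
`R1: startTs := newTimestamp(); cand := NULL; todo := the set of all pools;`
`R2: if todo = ∅ then go to R4, else choose any k in todo, remove k from todo, and`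
`r := getOldest(pool k);`
`R3: if r ≠ NULL and r.ts < cand.ts and r.ts < startTs then cand := r; go to R2;`
`R4: if cand = NULL then go to R1, else x := remove(cand); if x = NULL then go to R1;`
`R5: return x`. -/
inductive DeqLoc (n : ℕ) : Type
  | r1
  | r2 (startTs : ℤ) (cand : Option (Cand n)) (todo : Finset (Fin n))
  | r3 (startTs : ℤ) (cand : Option (Cand n)) (todo : Finset (Fin n)) (k : Fin n)
      (r : Option (ℕ × Timestamp))
  | r4 (cand : Option (Cand n))
  | r5 (x : ℕ)

inductive EnqStep {n : ℕ} (i : Fin n) : Mem n → EnqLoc → Mem n → EnqLoc → Prop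
  | n1 (σ : Mem n) (v : ℕ) :
      EnqStep i σ (.n1 v) (σ.insert i v) (.n2 σ.fresh)
  | n2 (σ : Mem n) (p : ℕ) :
      EnqStep i σ (.n2 p) σ.tick (.n3 p σ.clock)
  | n3 (σ : Mem n) (p : ℕ) (t : ℤ) :
      EnqStep i σ (.n3 p t) (σ.setTimestamp i p (t : Timestamp)) .n4

inductive DeqStep {n : ℕ} : Mem n → DeqLoc n → Mem n → DeqLoc n → Prop
  | r1 (σ : Mem n) :
      DeqStep σ .r1 σ.tick (.r2 σ.clock none Finset.univ)
  | r2_done (σ : Mem n) (t : ℤ) (c : Option (Cand n)) :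
      DeqStep σ (.r2 t c ∅) σ (.r4 c)
  | r2_scan (σ : Mem n) (t : ℤ) (c : Option (Cand n)) (todo : Finset (Fin n)) (k : Fin n) :
      k ∈ todo →
      DeqStep σ (.r2 t c todo) σ (.r3 t c (todo.erase k) k (σ.getOldest k))
  | r3_empty (σ : Mem n) (t : ℤ) (c : Option (Cand n)) (todo : Finset (Fin n)) (k : Fin n) :
      DeqStep σ (.r3 t c todo k none) σ (.r2 t c todo)
  | r3_take (σ : Mem n) (t : ℤ) (c : Option (Cand n)) (todo : Finset (Fin n)) (k : Fin n)
      (p : ℕ) (u : Timestamp) :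
      (u < candTs c ∧ u < (t : Timestamp)) →
      DeqStep σ (.r3 t c todo k (some (p, u))) σ (.r2 t (some ⟨k, p, u⟩) todo)
  | r3_skip (σ : Mem n) (t : ℤ) (c : Option (Cand n)) (todo : Finset (Fin n)) (k : Fin n)
      (p : ℕ) (u : Timestamp) :
      ¬ (u < candTs c ∧ u < (t : Timestamp)) →
      DeqStep σ (.r3 t c todo k (some (p, u))) σ (.r2 t c todo)
  | r4_none (σ : Mem n) :
      DeqStep σ (.r4 none) σ .r1
  | r4_fail (σ : Mem n) (c : Cand n) :
      σ.valueOf c.pool c.id = none →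
      DeqStep σ (.r4 (some c)) σ .r1
  | r4_remove (σ : Mem n) (c : Cand n) (x : ℕ) :
      σ.valueOf c.pool c.id = some x →
      DeqStep σ (.r4 (some c)) (σ.remove c.pool c.id) (.r5 x)

end TSQ

/-- The time-stamped queue. -/
def tsq : ConcurrentObject queueSig where
  Mem n := TSQ.Mem n
  Loc n
    | .enq => TSQ.EnqLoc
    | .deq => TSQ.DeqLoc n
  mem₀ _ := ⟨fun _ => [], 0, 0⟩
  start _
    | .enq => fun v => TSQ.EnqLoc.n1 v
    | .deq => fun _ => TSQ.DeqLoc.r1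
  step _ i
    | .enq => TSQ.EnqStep i
    | .deq => TSQ.DeqStep
  result _
    | .enq => fun s _ => s = TSQ.EnqLoc.n4
    | .deq => fun s x => s = TSQ.DeqLoc.r5 x

end ConcObj

open Relation

namespace ConcObj

/-! ### Paths made of internal steps of one process -/

/-! A step `E1` is matched by insertion and timestamp draw in one burst, so node identifiers, array
indices and timestamps are all handed out in the same order. The ghost map `τ` records the timestamp
drawn for each identifier, including those not yet attached and those of removed nodes. Writing the
array cell (`E2`) is matched by attaching the timestamp. Hence full cells are exactly the nodes with
an integer timestamp, and a node with timestamp `⊤` is a reserved cell still empty.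

For a dequeuer, reading `X` is matched by drawing `startTs`: the cells below `l` are then exactly
those with timestamps below `startTs`. The order in which pools are read is left open and fixed
lazily, while the array is traversed. If an empty cell belongs to a pending enqueuer whose pool is
unread, that pool is read at this moment; its oldest node has timestamp `⊤`, so it gives no
candidate (`ScanRel.next`). Thus every unread pool contains only cells from `j` on. If cell `j` is
full, its node is the oldest of an unread pool and has the least timestamp among the unread pools;
all remaining pools are read and the node is removed in one burst, so removal cannot fail
(`ScanRel.found`). If the traversal reaches `l`, the unread pools hold no timestamp below `startTs`,
and the round fails as well (`ScanRel.finish`).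

Interference by other processes is summarised once by `Frame`, under which all local relations are
stable. -/

theorem LTS.Path.append {L : Type} {A : LTS L} {q q' q'' : A.State} {l l' : List L}
    (h : A.Path q l q') (h' : A.Path q' l' q'') : A.Path q (l ++ l') q'' := by
  induction h with
  | nil => exact h'
  | cons ht _ ih => exact .cons ht (ih h')

/-- One atomic command of method `m`, executed by process `i`. -/
def LocalStep {S : Signature} (O : ConcurrentObject S) (n : ℕ) (i : Fin n) (m : S.Meth)
    (a b : O.Mem n × O.Loc n m) : Prop :=
  O.step n i m a.1 a.2 b.1 b.2

/-- Allows matching runs to be built from the memory and the local state of one process only, the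
other processes standing still. -/
theorem path_of_localSteps {S : Signature} {O : ConcurrentObject S} {n : ℕ} {i : Fin n}
    {m : S.Meth} (proc : Fin n → Option ((m : S.Meth) × O.Loc n m))
    {a b : O.Mem n × O.Loc n m} (hi : proc i = some ⟨m, a.2⟩)
    (h : ReflTransGen (LocalStep O n i m) a b) :
    ∃ l, (sem O n).Path ⟨a.1, proc⟩ l ⟨b.1, Function.update proc i (some ⟨m, b.2⟩)⟩ ∧
      history l = [] := by
  induction h with
  | refl => exact ⟨[], by rw [← hi, Function.update_eq_self]; exact .nil _, rfl⟩
  | @tail b c _ hbc ih =>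
    obtain ⟨l, hl, hh⟩ := ih
    refine ⟨l ++ [.internal i], hl.append (.cons ?_ (.nil _)), ?_⟩
    · change Config.Step O n _ _ _
      have := Config.Step.internal (O := O) (n := n)
        ⟨b.1, Function.update proc i (some ⟨m, b.2⟩)⟩ i m b.2 c.2 c.1 (by simp) hbc
      simpa using this
    · unfold history at hh ⊢
      simp [List.filter_append, hh, Action.visible]

/-! ### Scans of the time-stamped queue -/

namespace TSQ

variable {n : ℕ}

theorem scan_skip_one (i : Fin n) {μ : Mem n} {s : ℤ} {c : Option (Cand n)}
    {todo : Finset (Fin n)} {k : Fin n} (hk : k ∈ todo)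
    (h : ∀ nd ∈ (μ.pool k).head?, ¬ (nd.ts < candTs c ∧ nd.ts < (s : Timestamp))) :
    ReflTransGen (LocalStep tsq n i .deq) (μ, DeqLoc.r2 s c todo)
      (μ, DeqLoc.r2 s c (todo.erase k)) := by
  refine .head (b := (μ, DeqLoc.r3 s c (todo.erase k) k (μ.getOldest k)))
    (DeqStep.r2_scan μ s c todo k hk) (.single ?_)
  unfold Mem.getOldest
  cases hp : (μ.pool k).head? with
  | none => exact DeqStep.r3_empty μ s c _ k
  | some nd => exact DeqStep.r3_skip μ s c _ k nd.id nd.ts (h nd (by simp [hp]))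

theorem scan_skip (i : Fin n) {μ : Mem n} {s : ℤ} {c : Option (Cand n)}
    (todo : Finset (Fin n))
    (h : ∀ k ∈ todo, ∀ nd ∈ (μ.pool k).head?,
      ¬ (nd.ts < candTs c ∧ nd.ts < (s : Timestamp))) :
    ReflTransGen (LocalStep tsq n i .deq) (μ, DeqLoc.r2 s c todo) (μ, DeqLoc.r4 c) := by
  induction todo using Finset.strongInduction with
  | H todo ih =>
    rcases todo.eq_empty_or_nonempty with rfl | ⟨k, hk⟩
    · exact .single (DeqStep.r2_done μ s c)
    · exact (scan_skip_one i hk (h k hk)).trans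
        (ih _ (Finset.erase_ssubset hk) fun k' hk' => h k' (Finset.mem_of_mem_erase hk'))

/-- Pool `k` is read first; its node is then a candidate that no other pool can displace, since
displacing needs a strictly smaller timestamp. -/
theorem scan_take (i : Fin n) {μ : Mem n} {s : ℤ} {todo : Finset (Fin n)} {k : Fin n}
    {nd : Node} (hk : k ∈ todo) (hnd : (μ.pool k).head? = some nd)
    (hs : nd.ts < (s : Timestamp))
    (h : ∀ k' ∈ todo, k' ≠ k → ∀ nd' ∈ (μ.pool k').head?, ¬ nd'.ts < nd.ts) :
    ReflTransGen (LocalStep tsq n i .deq) (μ, DeqLoc.r2 s none todo)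
      (μ, DeqLoc.r4 (some ⟨k, nd.id, nd.ts⟩)) := by
  refine .head (b := (μ, DeqLoc.r3 s none (todo.erase k) k (some (nd.id, nd.ts)))) ?_
    (.head (b := (μ, DeqLoc.r2 s (some ⟨k, nd.id, nd.ts⟩) (todo.erase k))) ?_
      (scan_skip i _ ?_))
  · have := DeqStep.r2_scan μ s none todo k hk
    rw [Mem.getOldest, hnd] at this
    exact this
  · exact DeqStep.r3_take μ s none _ k nd.id nd.ts ⟨lt_of_lt_of_le hs le_top, hs⟩
  · intro k' hk' nd' hnd' hlt
    exact h k' (Finset.mem_of_mem_erase hk') (Finset.ne_of_mem_erase hk') nd' hnd' hlt.1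

end TSQ

/-! ### The simulation relation -/

namespace HWQSimulation

open TSQ (Node Timestamp)

variable {n : ℕ}

/-- The order of the nodes of a pool: identifiers increase, and only the last timestamp can be
`⊤`. -/
def Before (a b : Node) : Prop := a.id < b.id ∧ a.ts ≠ ⊤

/-- The memories of the two queues agree. The node with identifier `p` corresponds to the array
cell `p + 1`, and `τ p` is the timestamp drawn for it. -/
structure MemRel (σ : HWQ.Mem) (μ : TSQ.Mem n) (τ : ℕ → ℤ) : Prop where
  next_index : σ.X = μ.fresh + 1
  strictMono : ∀ p q, p < q → q < μ.fresh → τ p < τ q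
  lt_clock : ∀ p < μ.fresh, τ p < μ.clock
  sorted : ∀ k, (μ.pool k).Pairwise Before
  lt_fresh : ∀ k, ∀ nd ∈ μ.pool k, nd.id < μ.fresh
  node : ∀ k, ∀ nd ∈ μ.pool k,
    (nd.ts = (τ nd.id : Timestamp) ∧ σ.Q (nd.id + 1) = some nd.val) ∨
      (nd.ts = ⊤ ∧ σ.Q (nd.id + 1) = none)
  cover : ∀ p x, σ.Q (p + 1) = some x → ∃ k, ∃ nd ∈ μ.pool k, nd.id = p
  owner : ∀ k k', ∀ nd ∈ μ.pool k, ∀ nd' ∈ μ.pool k', nd.id = nd'.id → k = k'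

/-- A dequeuer of the Herlihy-Wing queue that is about to inspect cell `j` of the cells below `l`
corresponds to a scan with start timestamp `s`, no candidate, and the pools `todo` still to be
read. -/
structure ScanRel (μ : TSQ.Mem n) (τ : ℕ → ℤ) (l j : ℕ) (s : ℤ) (todo : Finset (Fin n)) :
    Prop where
  one_le : 1 ≤ j
  le : j ≤ l
  le_next : l ≤ μ.fresh + 1
  le_clock : s ≤ μ.clock
  lt_iff : ∀ p < μ.fresh, p + 1 < l ↔ τ p < s
  unread : ∀ k ∈ todo, ∀ nd ∈ μ.pool k, j ≤ nd.id + 1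
  read : ∀ k ∉ todo, ∀ nd ∈ μ.pool k, nd.id + 1 < l → nd.id + 1 < j

/-- Holds for the pool of a process with no reserved but unpublished cell. It guarantees that a
newly inserted `⊤` node is the only one of its pool. -/
def NoTop (pl : List Node) : Prop := ∀ nd ∈ pl, nd.ts ≠ ⊤

/-- The location `n2` has no partner because insertion and timestamp draw are never separated. -/
def EnqRel (i : Fin n) (μ : TSQ.Mem n) (τ : ℕ → ℤ) : HWQ.EnqLoc → TSQ.EnqLoc → Prop
  | .e1 v, .n1 w => v = w ∧ NoTop (μ.pool i)
  | .e2 v x, .n3 p t => x = p + 1 ∧ t = τ p ∧ p < μ.fresh ∧ (⟨p, v, ⊤⟩ : Node) ∈ μ.pool i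
  | .e3, .n4 => NoTop (μ.pool i)
  | _, _ => False

/-- A candidate exists only inside the burst that removes it, so between matched steps a scan has
none. -/
def DeqRel (μ : TSQ.Mem n) (τ : ℕ → ℤ) : HWQ.DeqLoc → TSQ.DeqLoc n → Prop
  | .d1, .r1 => True
  | .d2 l, .r2 s none todo => ScanRel μ τ l 1 s todo
  | .d3 l j, .r2 s none todo => j < l ∧ ScanRel μ τ l j s todo
  | .d4 x, .r5 y => x = y
  | _, _ => False

def ProcRel (i : Fin n) (μ : TSQ.Mem n) (τ : ℕ → ℤ) :
    Option ((m : QMeth) × hwq.Loc n m) → Option ((m : QMeth) × tsq.Loc n m) → Prop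
  | none, none => NoTop (μ.pool i)
  | some ⟨.enq, s⟩, some ⟨.enq, t⟩ => EnqRel i μ τ s t
  | some ⟨.deq, s⟩, some ⟨.deq, t⟩ => NoTop (μ.pool i) ∧ DeqRel μ τ s t
  | _, _ => False

/-- The simulation relation. -/
def Rel (c : Config hwq n) (d : Config tsq n) : Prop :=
  ∃ τ, MemRel c.mem d.mem τ ∧ ∀ i, ProcRel i d.mem τ (c.proc i) (d.proc i)

/-- The changes of the memory of the time-stamped queue that a step of process `i` can make. -/
structure Frame (i : Fin n) (μ μ' : TSQ.Mem n) (τ τ' : ℕ → ℤ) : Prop where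
  fresh_le : μ.fresh ≤ μ'.fresh
  clock_le : μ.clock ≤ μ'.clock
  old : ∀ p < μ.fresh, τ' p = τ p
  new : ∀ p, μ.fresh ≤ p → p < μ'.fresh → μ.clock ≤ τ' p
  top : ∀ k, k ≠ i → ∀ nd : Node, nd.ts = ⊤ → (nd ∈ μ'.pool k ↔ nd ∈ μ.pool k)
  ids : ∀ k, ∀ nd ∈ μ'.pool k, μ.fresh ≤ nd.id ∨ ∃ nd₀ ∈ μ.pool k, nd₀.id = nd.id

/-! ### Stability under the steps of other processes -/

theorem Frame.refl (i : Fin n) (μ : TSQ.Mem n) (τ : ℕ → ℤ) : Frame i μ μ τ τ where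
  fresh_le := le_rfl
  clock_le := le_rfl
  old _ _ := rfl
  new p h h' := absurd h' (by omega)
  top _ _ _ _ := Iff.rfl
  ids _ nd h := .inr ⟨nd, h, rfl⟩

/-- A node created after the scan began lies at a cell `≥ l` and has a timestamp at least the clock,
hence at least `s`: it is invisible to both traversals. Removals only weaken what has to be checked.
-/
theorem ScanRel.frame {i : Fin n} {μ μ' : TSQ.Mem n} {τ τ' : ℕ → ℤ}
    (f : Frame i μ μ' τ τ') {l j : ℕ} {s : ℤ} {todo : Finset (Fin n)}
    (h : ScanRel μ τ l j s todo) : ScanRel μ' τ' l j s todo where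
  one_le := h.one_le
  le := h.le
  le_next := by have := h.le_next; have := f.fresh_le; omega
  le_clock := h.le_clock.trans f.clock_le
  lt_iff p hp := by
    by_cases hp' : p < μ.fresh
    · rw [f.old p hp', h.lt_iff p hp']
    · have := f.new p (by omega) hp
      have := h.le_next
      have := h.le_clock
      constructor <;> intro <;> omega
  unread k hk nd hnd := by
    rcases f.ids k nd hnd with h' | ⟨nd₀, h₀, e⟩
    · have := h.le; have := h.le_next; omega
    · rw [← e]; exact h.unread k hk nd₀ h₀
  read k hk nd hnd hl := by
    rcases f.ids k nd hnd with h' | ⟨nd₀, h₀, e⟩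
    · have := h.le_next; omega
    · rw [← e] at hl ⊢; exact h.read k hk nd₀ h₀ hl

theorem NoTop.frame {i k : Fin n} {μ μ' : TSQ.Mem n} {τ τ' : ℕ → ℤ}
    (f : Frame i μ μ' τ τ') (hk : k ≠ i) (h : NoTop (μ.pool k)) : NoTop (μ'.pool k) :=
  fun nd hnd ht => h nd ((f.top k hk nd ht).1 hnd) ht

theorem DeqRel.frame {i : Fin n} {μ μ' : TSQ.Mem n} {τ τ' : ℕ → ℤ}
    (f : Frame i μ μ' τ τ') {s : HWQ.DeqLoc} {t : TSQ.DeqLoc n}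
    (h : DeqRel μ τ s t) : DeqRel μ' τ' s t := by
  unfold DeqRel at h ⊢
  split at h
  · trivial
  · exact ScanRel.frame f h
  · exact ⟨h.1, ScanRel.frame f h.2⟩
  · exact h
  · exact h.elim

theorem EnqRel.frame {i k : Fin n} {μ μ' : TSQ.Mem n} {τ τ' : ℕ → ℤ}
    (f : Frame i μ μ' τ τ') (hk : k ≠ i) {s : HWQ.EnqLoc} {t : TSQ.EnqLoc}
    (h : EnqRel k μ τ s t) : EnqRel k μ' τ' s t := by
  unfold EnqRel at h ⊢
  split at h
  · exact ⟨h.1, NoTop.frame f hk h.2⟩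
  · obtain ⟨hx, ht, hp, hm⟩ := h
    exact ⟨hx, by rw [f.old _ hp, ht], hp.trans_le f.fresh_le, (f.top k hk _ rfl).2 hm⟩
  · exact NoTop.frame f hk h
  · exact h.elim

theorem ProcRel.frame {i k : Fin n} {μ μ' : TSQ.Mem n} {τ τ' : ℕ → ℤ}
    (f : Frame i μ μ' τ τ') (hk : k ≠ i) {a : Option ((m : QMeth) × hwq.Loc n m)}
    {b : Option ((m : QMeth) × tsq.Loc n m)}
    (h : ProcRel k μ τ a b) : ProcRel k μ' τ' a b := by
  rcases a with _ | ⟨_ | _, s⟩ <;> rcases b with _ | ⟨_ | _, t⟩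
  all_goals first
    | exact h.elim
    | exact NoTop.frame f hk h
    | exact EnqRel.frame f hk h
    | exact ⟨NoTop.frame f hk h.1, DeqRel.frame f h.2⟩

/-! ### Pools -/

theorem Before.total {pl : List Node} (h : pl.Pairwise Before) {a b : Node} (ha : a ∈ pl)
    (hb : b ∈ pl) : a = b ∨ Before a b ∨ Before b a := by
  induction h with
  | nil => simp at ha
  | cons hx _ ih =>
    rcases List.mem_cons.1 ha with ha' | ha' <;> rcases List.mem_cons.1 hb with hb' | hb'
    · exact .inl (ha'.trans hb'.symm)
    · exact .inr (.inl (ha' ▸ hx _ hb'))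
    · exact .inr (.inr (hb' ▸ hx _ ha'))
    · exact ih ha' hb'

theorem eq_of_id_eq {pl : List Node} (h : pl.Pairwise Before) {a b : Node} (ha : a ∈ pl)
    (hb : b ∈ pl) (hid : a.id = b.id) : a = b := by
  rcases Before.total h ha hb with h | h | h
  · exact h
  · have := h.1; omega
  · have := h.1; omega

theorem eq_of_ts_eq_top {pl : List Node} (h : pl.Pairwise Before) {a b : Node} (ha : a ∈ pl)
    (hb : b ∈ pl) (hta : a.ts = ⊤) (htb : b.ts = ⊤) : a = b := by
  rcases Before.total h ha hb with h | h | h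
  · exact h
  · exact absurd hta h.2
  · exact absurd htb h.2

theorem id_le_of_ts_eq_top {pl : List Node} (h : pl.Pairwise Before) {a b : Node}
    (ha : a ∈ pl) (hb : b ∈ pl) (hta : a.ts = ⊤) : b.id ≤ a.id := by
  rcases Before.total h ha hb with h | h | h
  · rw [h]
  · exact absurd hta h.2
  · exact h.1.le

theorem head?_eq_of_id_le {pl : List Node} (h : pl.Pairwise Before) {a : Node}
    (ha : a ∈ pl) (hmin : ∀ b ∈ pl, a.id ≤ b.id) : pl.head? = some a := by
  cases h with
  | nil => simp at ha
  | cons hx _ =>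
    rcases List.mem_cons.1 ha with rfl | ha
    · rfl
    · have := (hx _ ha).1
      have := hmin _ List.mem_cons_self
      omega

/-! ### Steps of an enqueuer -/

/-- Identifier and timestamp are drawn together, both above all earlier ones, which keeps `τ`
strictly increasing. -/
theorem MemRel.reserve {σ : HWQ.Mem} {μ : TSQ.Mem n} {τ : ℕ → ℤ} (h : MemRel σ μ τ)
    (i : Fin n) (v : ℕ) (hi : NoTop (μ.pool i)) :
    MemRel { σ with X := σ.X + 1 } (μ.insert i v).tick
        (Function.update τ μ.fresh μ.clock) ∧
      Frame i μ (μ.insert i v).tick τ (Function.update τ μ.fresh μ.clock) := by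
  have hpool : ∀ k, ∀ nd ∈ (μ.insert i v).tick.pool k,
      nd ∈ μ.pool k ∨ (k = i ∧ nd = ⟨μ.fresh, v, ⊤⟩) := by
    intro k nd hnd
    by_cases hk : k = i
    · subst hk
      simpa [TSQ.Mem.tick, TSQ.Mem.insert] using hnd
    · left
      simpa [TSQ.Mem.tick, TSQ.Mem.insert, Function.update_of_ne hk] using hnd
  have hsub : ∀ k, ∀ nd ∈ μ.pool k, nd ∈ (μ.insert i v).tick.pool k := by
    intro k nd hnd
    by_cases hk : k = i
    · subst hk
      simp [TSQ.Mem.tick, TSQ.Mem.insert, hnd]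
    · simpa [TSQ.Mem.tick, TSQ.Mem.insert, Function.update_of_ne hk] using hnd
  have hf : (μ.insert i v).tick.fresh = μ.fresh + 1 := rfl
  have hc : (μ.insert i v).tick.clock = μ.clock + 1 := rfl
  have hold : ∀ p < μ.fresh, Function.update τ μ.fresh μ.clock p = τ p :=
    fun p hp => Function.update_of_ne hp.ne _ _
  refine ⟨⟨?_, ?_, ?_, ?_, ?_, ?_, ?_, ?_⟩, ⟨by omega, by omega, hold, ?_, ?_, ?_⟩⟩
  · rw [hf, ← h.next_index]
  · intro p q hpq hq
    rw [hf] at hq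
    rw [hold p (by omega)]
    rcases Nat.lt_succ_iff_lt_or_eq.1 hq with hq | rfl
    · rw [hold q hq]; exact h.strictMono p q hpq hq
    · rw [Function.update_self]; exact h.lt_clock p hpq
  · intro p hp
    rw [hf] at hp
    rw [hc]
    rcases Nat.lt_succ_iff_lt_or_eq.1 hp with hp | rfl
    · rw [hold p hp]; have := h.lt_clock p hp; omega
    · rw [Function.update_self]; omega
  · intro k
    by_cases hk : k = i
    · subst hk
      simp only [TSQ.Mem.tick, TSQ.Mem.insert, Function.update_self]
      rw [List.pairwise_append]
      refine ⟨h.sorted k, List.pairwise_singleton _ _, ?_⟩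
      intro a ha b hb
      rw [List.mem_singleton.1 hb]
      exact ⟨h.lt_fresh k a ha, hi a ha⟩
    · simpa [TSQ.Mem.tick, TSQ.Mem.insert, Function.update_of_ne hk] using h.sorted k
  · intro k nd hnd
    rcases hpool k nd hnd with hnd | ⟨-, rfl⟩
    · have := h.lt_fresh k nd hnd; omega
    · rw [hf]; exact Nat.lt_succ_self _
  · intro k nd hnd
    rcases hpool k nd hnd with hnd | ⟨-, rfl⟩
    · rw [hold _ (h.lt_fresh k nd hnd)]; exact h.node k nd hnd
    · refine .inr ⟨rfl, ?_⟩
      -- The reserved cell is empty: a full one would have a node with the unused identifier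
      -- `μ.fresh`.
      cases hQ : σ.Q (μ.fresh + 1) with
      | none => rfl
      | some x =>
        obtain ⟨k', nd, hnd, e⟩ := h.cover _ _ hQ
        have := h.lt_fresh k' nd hnd
        omega
  · intro p x hp
    obtain ⟨k, nd, hnd, e⟩ := h.cover p x hp
    exact ⟨k, nd, hsub k nd hnd, e⟩
  · intro k k' nd hnd nd' hnd' e
    rcases hpool k nd hnd with hnd | ⟨hk, rfl⟩ <;>
      rcases hpool k' nd' hnd' with hnd' | ⟨hk', rfl⟩
    · exact h.owner k k' nd hnd nd' hnd' e
    · have := h.lt_fresh k nd hnd; simp at e; omega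
    · have := h.lt_fresh k' nd' hnd'; simp at e; omega
    · rw [hk, hk']
  · intro p hp hp'
    have : p = μ.fresh := by omega
    rw [this, Function.update_self]
  · intro k hk nd _
    exact ⟨fun hnd => (hpool k nd hnd).resolve_right fun h' => hk h'.1, hsub k nd⟩
  · intro k nd hnd
    rcases hpool k nd hnd with hnd | ⟨-, rfl⟩
    · exact .inr ⟨nd, hnd, rfl⟩
    · exact .inl le_rfl

theorem MemRel.publish {σ : HWQ.Mem} {μ : TSQ.Mem n} {τ : ℕ → ℤ} (h : MemRel σ μ τ)
    {i : Fin n} {p v : ℕ} (hp : (⟨p, v, ⊤⟩ : Node) ∈ μ.pool i) :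
    MemRel { σ with Q := Function.update σ.Q (p + 1) (some v) }
        (μ.setTimestamp i p (τ p : Timestamp)) τ ∧
      Frame i μ (μ.setTimestamp i p (τ p : Timestamp)) τ τ ∧
      NoTop ((μ.setTimestamp i p (τ p : Timestamp)).pool i) := by
  set μ' := μ.setTimestamp i p (τ p : Timestamp) with hμ'
  have hmem : ∀ k nd, nd ∈ μ'.pool k ↔
      (nd ∈ μ.pool k ∧ nd.id ≠ p) ∨ (k = i ∧ nd = ⟨p, v, (τ p : Timestamp)⟩) := by
    intro k nd
    by_cases hk : k = i
    · subst hk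
      simp only [hμ', TSQ.Mem.setTimestamp, Function.update_self, List.mem_map, true_and]
      constructor
      · rintro ⟨nd₀, h₀, rfl⟩
        split_ifs with e
        · right
          rw [eq_of_id_eq (h.sorted k) h₀ hp e]
        · exact .inl ⟨h₀, e⟩
      · rintro (⟨h₀, e⟩ | rfl)
        · exact ⟨nd, h₀, if_neg e⟩
        · exact ⟨_, hp, if_pos rfl⟩
    · simp only [hμ', TSQ.Mem.setTimestamp, Function.update_of_ne hk, hk, false_and, or_false]
      -- Identifiers are unique across pools, so `p` does not occur outside pool `i`.
      exact ⟨fun hnd => ⟨hnd, fun e => hk (h.owner k i nd hnd _ hp e)⟩, fun hnd => hnd.1⟩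
  have hid : ∀ k, ∀ nd ∈ μ'.pool k, ∃ nd₀ ∈ μ.pool k, nd₀.id = nd.id := by
    intro k nd hnd
    rcases (hmem k nd).1 hnd with h' | ⟨rfl, rfl⟩
    · exact ⟨nd, h'.1, rfl⟩
    · exact ⟨_, hp, rfl⟩
  have hf : μ'.fresh = μ.fresh := rfl
  refine ⟨⟨h.next_index, h.strictMono, h.lt_clock, ?_, ?_, ?_, ?_, ?_⟩,
    ⟨le_rfl, le_rfl, fun _ _ => rfl, ?_, ?_, fun k nd hnd => .inr (hid k nd hnd)⟩, ?_⟩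
  · intro k
    by_cases hk : k = i
    · subst hk
      simp only [hμ', TSQ.Mem.setTimestamp, Function.update_self]
      refine List.pairwise_map.2 ((h.sorted k).imp ?_)
      rintro a b ⟨hab, ht⟩
      constructor
      · split_ifs <;> exact hab
      · split_ifs
        · exact WithTop.coe_ne_top
        · exact ht
    · simpa [hμ', TSQ.Mem.setTimestamp, Function.update_of_ne hk] using h.sorted k
  · intro k nd hnd
    obtain ⟨nd₀, h₀, e⟩ := hid k nd hnd
    rw [← e]; exact h.lt_fresh k nd₀ h₀
  · intro k nd hnd
    rcases (hmem k nd).1 hnd with ⟨h₀, e⟩ | ⟨-, rfl⟩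
    · have e' : nd.id + 1 ≠ p + 1 := by omega
      simpa only [Function.update_of_ne e'] using h.node k nd h₀
    · exact .inl ⟨rfl, Function.update_self ..⟩
  · intro q x hq
    by_cases e : q = p
    · exact ⟨i, _, (hmem i _).2 (.inr ⟨rfl, rfl⟩), e.symm⟩
    · have e' : q + 1 ≠ p + 1 := by omega
      simp only [Function.update_of_ne e'] at hq
      obtain ⟨k, nd, hnd, rfl⟩ := h.cover q x hq
      exact ⟨k, nd, (hmem k nd).2 (.inl ⟨hnd, e⟩), rfl⟩
  · intro k k' nd hnd nd' hnd' e
    obtain ⟨a, ha, ea⟩ := hid k nd hnd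
    obtain ⟨b, hb, eb⟩ := hid k' nd' hnd'
    exact h.owner k k' a ha b hb (by omega)
  · intro q hq hq'
    omega
  · intro k hk nd _
    simp [hμ', TSQ.Mem.setTimestamp, Function.update_of_ne hk]
  -- A pool has at most one `⊤` node, and that node has just received its timestamp.
  · intro nd hnd ht
    rcases (hmem i nd).1 hnd with ⟨h₀, e⟩ | ⟨-, rfl⟩
    · exact e (congrArg Node.id (eq_of_ts_eq_top (h.sorted i) h₀ hp ht rfl))
    · exact WithTop.coe_ne_top ht

theorem enqStep {σ σ' : HWQ.Mem} {μ : TSQ.Mem n} {τ : ℕ → ℤ} (h : MemRel σ μ τ) {i : Fin n}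
    {s s' : HWQ.EnqLoc} {t : TSQ.EnqLoc} (hr : EnqRel i μ τ s t)
    (hs : HWQ.EnqStep σ s σ' s') :
    ∃ μ' t' τ', ReflTransGen (LocalStep tsq n i .enq) (μ, t) (μ', t') ∧
      MemRel σ' μ' τ' ∧ Frame i μ μ' τ τ' ∧ EnqRel i μ' τ' s' t' := by
  cases hs with
  | e1 v =>
    cases t with
    | n1 w =>
      obtain ⟨rfl, hi⟩ := hr
      obtain ⟨hm, hf⟩ := h.reserve i v hi
      refine ⟨_, .n3 μ.fresh μ.clock, _, ?_, hm, hf, h.next_index, ?_, ?_, ?_⟩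
      · exact .head (b := (μ.insert i v, TSQ.EnqLoc.n2 μ.fresh)) (TSQ.EnqStep.n1 μ v)
          (.single (TSQ.EnqStep.n2 (μ.insert i v) μ.fresh))
      · rw [Function.update_self]
      · exact Nat.lt_succ_self _
      · simp [TSQ.Mem.tick, TSQ.Mem.insert]
    | _ => exact hr.elim
  | e2 v x =>
    cases t with
    | n3 p t =>
      obtain ⟨rfl, rfl, -, hp⟩ := hr
      obtain ⟨hm, hf, ht⟩ := h.publish hp
      exact ⟨_, .n4, τ, .single (TSQ.EnqStep.n3 μ p (τ p)), hm, hf, ht⟩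
    | _ => exact hr.elim

/-! ### Steps of a dequeuer -/

/-- When `X` is read and the start timestamp is drawn together, every identifier issued so far lies
below both bounds. -/
theorem MemRel.tick {σ : HWQ.Mem} {μ : TSQ.Mem n} {τ : ℕ → ℤ} (h : MemRel σ μ τ)
    (i : Fin n) :
    MemRel σ μ.tick τ ∧ Frame i μ μ.tick τ τ ∧ ScanRel μ.tick τ σ.X 1 μ.clock Finset.univ := by
  have hc : μ.tick.clock = μ.clock + 1 := rfl
  have hf : μ.tick.fresh = μ.fresh := rfl
  refine ⟨⟨h.next_index, h.strictMono, fun p hp => ?_, h.sorted, h.lt_fresh, h.node, h.cover,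
    h.owner⟩, ⟨le_rfl, by omega, fun _ _ => rfl, fun p hp hp' => by omega,
    fun _ _ _ _ => Iff.rfl, fun _ nd h => .inr ⟨nd, h, rfl⟩⟩,
    ⟨le_rfl, ?_, ?_, by omega, fun p hp => ?_, fun _ _ _ _ => by omega, by simp⟩⟩
  · have := h.lt_clock p hp; omega
  · rw [h.next_index]; omega
  · rw [h.next_index, hf]
  · have := h.lt_clock p hp
    have := h.next_index
    have : p < μ.fresh := hp
    constructor <;> intro <;> omega

/-- The hypothesis on the timestamp protects pending enqueuers, whose `⊤` nodes must stay in their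
pools. -/
theorem MemRel.remove {σ : HWQ.Mem} {μ : TSQ.Mem n} {τ : ℕ → ℤ} (h : MemRel σ μ τ)
    (i : Fin n) {k : Fin n} {nd : Node} (hnd : nd ∈ μ.pool k) (ht : nd.ts ≠ ⊤) :
    MemRel { σ with Q := Function.update σ.Q (nd.id + 1) none } (μ.remove k nd.id) τ ∧
      Frame i μ (μ.remove k nd.id) τ τ ∧
      ∀ k', NoTop (μ.pool k') → NoTop ((μ.remove k nd.id).pool k') := by
  set μ' := μ.remove k nd.id with hμ'
  have hmem : ∀ k' a, a ∈ μ'.pool k' ↔ a ∈ μ.pool k' ∧ a.id ≠ nd.id := by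
    intro k' a
    by_cases hk : k' = k
    · subst hk
      simp [hμ', TSQ.Mem.remove]
    · simp only [hμ', TSQ.Mem.remove, Function.update_of_ne hk]
      exact ⟨fun ha => ⟨ha, fun e => hk (h.owner k' k a ha nd hnd e)⟩, fun ha => ha.1⟩
  have hf : μ'.fresh = μ.fresh := rfl
  refine ⟨⟨h.next_index, h.strictMono, h.lt_clock, ?_,
      fun k' a ha => h.lt_fresh k' a ((hmem k' a).1 ha).1, ?_, ?_,
      fun k₁ k₂ a ha b hb => h.owner k₁ k₂ a ((hmem _ _).1 ha).1 b ((hmem _ _).1 hb).1⟩,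
    ⟨le_rfl, le_rfl, fun _ _ => rfl, ?_, ?_,
      fun k' a ha => .inr ⟨a, ((hmem k' a).1 ha).1, rfl⟩⟩,
    fun k' hk' a ha => hk' a ((hmem k' a).1 ha).1⟩
  · intro k'
    by_cases hk : k' = k
    · subst hk
      simp only [hμ', TSQ.Mem.remove, Function.update_self]
      exact (h.sorted k').sublist List.filter_sublist
    · simpa [hμ', TSQ.Mem.remove, Function.update_of_ne hk] using h.sorted k'
  · intro k' a ha
    obtain ⟨ha, e⟩ := (hmem k' a).1 ha
    have e' : a.id + 1 ≠ nd.id + 1 := by omega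
    simpa only [Function.update_of_ne e'] using h.node k' a ha
  · intro q x hq
    by_cases e : q = nd.id
    · simp [e] at hq
    · have e' : q + 1 ≠ nd.id + 1 := by omega
      simp only [Function.update_of_ne e'] at hq
      obtain ⟨k', a, ha, rfl⟩ := h.cover q x hq
      exact ⟨k', a, (hmem k' a).2 ⟨ha, e⟩, rfl⟩
  · intro q hq hq'
    omega
  · intro k' _ a hat
    rw [hmem]
    refine ⟨fun ha => ha.1, fun ha => ⟨ha, fun e => ?_⟩⟩
    have hk := h.owner k' k a ha nd hnd e
    subst hk
    exact ht (eq_of_id_eq (h.sorted k') ha hnd e ▸ hat)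

/-- A scan that has passed all cells below `l` finds no candidate. -/
theorem ScanRel.finish {σ : HWQ.Mem} {μ : TSQ.Mem n} {τ : ℕ → ℤ} (h : MemRel σ μ τ)
    (i : Fin n) {l : ℕ} {s : ℤ} {todo : Finset (Fin n)} (hs : ScanRel μ τ l l s todo) :
    ReflTransGen (LocalStep tsq n i .deq) (μ, TSQ.DeqLoc.r2 s none todo)
      (μ, TSQ.DeqLoc.r1) := by
  refine (TSQ.scan_skip i todo ?_).tail (TSQ.DeqStep.r4_none μ)
  rintro k hk nd hnd ⟨-, hlt⟩
  have hnd' := List.mem_of_mem_head? hnd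
  -- An integer timestamp below `s` would put the node at a cell below `l`, but unread pools start
  -- at `l`.
  rcases h.node k nd hnd' with ⟨e, -⟩ | ⟨e, -⟩
  · rw [e, WithTop.coe_lt_coe, ← hs.lt_iff _ (h.lt_fresh k nd hnd')] at hlt
    have := hs.unread k hk nd hnd'
    omega
  · rw [e] at hlt
    exact not_top_lt hlt

/-- An empty cell `j` is passed: if its enqueuer is pending, then its pool is read now. -/
theorem ScanRel.next {σ : HWQ.Mem} {μ : TSQ.Mem n} {τ : ℕ → ℤ} (h : MemRel σ μ τ)
    (i : Fin n) {l j : ℕ} {s : ℤ} {todo : Finset (Fin n)} (hs : ScanRel μ τ l j s todo)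
    (hj : j < l) (hQ : σ.Q j = none) :
    ∃ todo', ReflTransGen (LocalStep tsq n i .deq) (μ, TSQ.DeqLoc.r2 s none todo)
        (μ, TSQ.DeqLoc.r2 s none todo') ∧ ScanRel μ τ l (j + 1) s todo' := by
  by_cases hex : ∃ k ∈ todo, ∃ nd ∈ μ.pool k, nd.id + 1 = j
  · obtain ⟨k, hk, nd, hnd, rfl⟩ := hex
    have htop : nd.ts = ⊤ := by
      rcases h.node k nd hnd with ⟨-, e⟩ | ⟨e, -⟩
      · rw [hQ] at e; cases e
      · exact e
    -- Unread pools contain no cell before the current one, so its node is the oldest.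
    have hhead : (μ.pool k).head? = some nd :=
      head?_eq_of_id_le (h.sorted k) hnd fun b hb => by
        have := hs.unread k hk b hb; omega
    refine ⟨todo.erase k, TSQ.scan_skip_one i hk ?_, by omega, hj, hs.le_next, hs.le_clock,
      hs.lt_iff, ?_, ?_⟩
    · rintro a ha ⟨-, hlt⟩
      rw [hhead, Option.mem_some_iff] at ha
      subst ha
      rw [htop] at hlt
      exact not_top_lt hlt
    · intro k' hk' a ha
      have := hs.unread k' (Finset.mem_of_mem_erase hk') a ha
      have : nd.id ≠ a.id := fun e =>
        Finset.ne_of_mem_erase hk' (h.owner k k' nd hnd a ha e).symm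
      omega
    · intro k' hk' a ha hl
      by_cases e : k' = k
      · subst e
        -- The `⊤` node is also the newest of its pool, so reading the pool now skips no cell
        -- between it and `l`.
        have := id_le_of_ts_eq_top (h.sorted k') hnd ha htop
        omega
      · have := hs.read k' (fun hm => hk' (Finset.mem_erase.2 ⟨e, hm⟩)) a ha hl
        omega
  -- The node of cell `j`, if there is one, lies in a pool already read, so the scan stands still.
  · push Not at hex
    refine ⟨todo, .refl, by omega, hj, hs.le_next, hs.le_clock, hs.lt_iff, ?_, ?_⟩
    · intro k hk a ha
      have := hs.unread k hk a ha
      have := hex k hk a ha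
      omega
    · intro k hk a ha hl
      have := hs.read k hk a ha hl
      omega

/-- If cell `j` is full, then the scan can be completed with its node as the candidate. -/
theorem ScanRel.found {σ : HWQ.Mem} {μ : TSQ.Mem n} {τ : ℕ → ℤ} (h : MemRel σ μ τ)
    (i : Fin n) {l j x : ℕ} {s : ℤ} {todo : Finset (Fin n)} (hs : ScanRel μ τ l j s todo)
    (hj : j < l) (hQ : σ.Q j = some x) :
    ∃ k, ∃ nd ∈ μ.pool k, nd.id + 1 = j ∧ nd.ts ≠ ⊤ ∧
      ReflTransGen (LocalStep tsq n i .deq) (μ, TSQ.DeqLoc.r2 s none todo)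
        (μ.remove k nd.id, TSQ.DeqLoc.r5 x) := by
  obtain ⟨p, rfl⟩ : ∃ p, j = p + 1 := ⟨j - 1, by have := hs.one_le; omega⟩
  obtain ⟨k, nd, hnd, rfl⟩ := h.cover p x hQ
  obtain ⟨hts, hval⟩ : nd.ts = (τ nd.id : Timestamp) ∧ nd.val = x := by
    rcases h.node k nd hnd with ⟨e, e'⟩ | ⟨-, e⟩
    · rw [hQ] at e'; exact ⟨e, (Option.some.inj e').symm⟩
    · rw [hQ] at e; cases e
  -- Pools already read contain no cell in the range from `j` to `l - 1`.
  have hk : k ∈ todo := by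
    by_contra hk
    exact lt_irrefl _ (hs.read k hk nd hnd hj)
  have hhead : (μ.pool k).head? = some nd :=
    head?_eq_of_id_le (h.sorted k) hnd fun b hb => by
      have := hs.unread k hk b hb; omega
  refine ⟨k, nd, hnd, rfl, by rw [hts]; exact WithTop.coe_ne_top,
    (TSQ.scan_take i hk hhead ?_ ?_).tail (TSQ.DeqStep.r4_remove μ _ x ?_)⟩
  · rw [hts, WithTop.coe_lt_coe, ← hs.lt_iff _ (h.lt_fresh k nd hnd)]
    exact hj
  -- Other unread pools start after cell `j`, so their timestamps are larger by monotonicity of `τ`,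
  -- or `⊤`.
  · intro k' hk' hne a ha hlt
    have ha' := List.mem_of_mem_head? ha
    rcases h.node k' a ha' with ⟨e, -⟩ | ⟨e, -⟩
    · rw [e, hts, WithTop.coe_lt_coe] at hlt
      have h1 := hs.unread k' hk' a ha'
      have h2 : nd.id ≠ a.id := fun e => hne (h.owner k k' nd hnd a ha' e).symm
      have h3 := h.strictMono nd.id a.id (by omega) (h.lt_fresh k' a ha')
      omega
    · rw [e] at hlt
      exact not_top_lt hlt
  · unfold TSQ.Mem.valueOf
    rw [List.head?_eq_some_iff] at hhead
    obtain ⟨tl, htl⟩ := hhead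
    simp [htl, hval]

theorem deqStep {σ σ' : HWQ.Mem} {μ : TSQ.Mem n} {τ : ℕ → ℤ} (h : MemRel σ μ τ) {i : Fin n}
    {s s' : HWQ.DeqLoc} {t : TSQ.DeqLoc n} (hi : NoTop (μ.pool i)) (hr : DeqRel μ τ s t)
    (hs : HWQ.DeqStep σ s σ' s') :
    ∃ μ' t', ReflTransGen (LocalStep tsq n i .deq) (μ, t) (μ', t') ∧
      MemRel σ' μ' τ ∧ Frame i μ μ' τ τ ∧ NoTop (μ'.pool i) ∧ DeqRel μ' τ s' t' := by
  unfold DeqRel at hr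
  split at hr
  · cases hs
    obtain ⟨hm, hf, hsc⟩ := h.tick i
    exact ⟨_, .r2 μ.clock none Finset.univ, .single (TSQ.DeqStep.r1 μ), hm, hf, hi, hsc⟩
  · cases hs with
    | d2_back l hl =>
      subst hl
      -- With `l = 1` the traversal is finished before it starts: `j = l = 1`.
      exact ⟨μ, .r1, ScanRel.finish h i hr, h, .refl .., hi, trivial⟩
    | d2_scan l hl =>
      exact ⟨μ, _, .refl, h, .refl .., hi, by have := hr.le; omega, hr⟩
  · cases hs with
    | d3_found l j x hQ =>
      obtain ⟨k, nd, hnd, rfl, ht, hp⟩ := ScanRel.found h i hr.2 hr.1 hQ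
      obtain ⟨hm, hf, hnt⟩ := h.remove i hnd ht
      exact ⟨_, .r5 x, hp, hm, hf, hnt i hi, rfl⟩
    | d3_back l j hQ hj =>
      obtain ⟨todo', hp, hsc⟩ := ScanRel.next h i hr.2 hr.1 hQ
      subst hj
      exact ⟨μ, .r1, hp.trans (ScanRel.finish h i hsc), h, .refl .., hi, trivial⟩
    | d3_next l j hQ hj =>
      obtain ⟨todo', hp, hsc⟩ := ScanRel.next h i hr.2 hr.1 hQ
      exact ⟨μ, .r2 _ none todo', hp, h, .refl .., hi, by have := hr.1; omega, hsc⟩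
  · cases hs
  · exact hr.elim

/-! ### The simulation -/

/-- Reduces every case of the simulation to the moving process; the others are covered by
`ProcRel.frame`. -/
theorem rel_of_frame {c : Config hwq n} {d : Config tsq n} {τ τ' : ℕ → ℤ} {i : Fin n}
    {σ' : HWQ.Mem} {μ' : TSQ.Mem n} {a : Option ((m : queueSig.Meth) × hwq.Loc n m)}
    {b : Option ((m : queueSig.Meth) × tsq.Loc n m)}
    (hp : ∀ k, ProcRel k d.mem τ (c.proc k) (d.proc k)) (hm : MemRel σ' μ' τ')
    (hf : Frame i d.mem μ' τ τ') (hi : ProcRel i μ' τ' a b) :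
    Rel ⟨σ', Function.update c.proc i a⟩ ⟨μ', Function.update d.proc i b⟩ := by
  refine ⟨τ', hm, fun k => ?_⟩
  by_cases hk : k = i
  · subst hk
    have ea : Function.update c.proc k a k = a := Function.update_self ..
    have eb : Function.update d.proc k b k = b := Function.update_self ..
    exact (congrArg₂ (ProcRel k μ' τ') ea eb).mpr hi
  · have ea : Function.update c.proc i a k = c.proc k := Function.update_of_ne hk ..
    have eb : Function.update d.proc i b k = d.proc k := Function.update_of_ne hk ..
    exact (congrArg₂ (ProcRel k μ' τ') ea eb).mpr ((hp k).frame hf hk)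

theorem isForwardSimulation (n : ℕ) :
    IsForwardSimulation (sem hwq n) (sem tsq n) (Rel (n := n)) where
  init := by
    -- No identifier has been issued yet, so any `τ` would do.
    refine ⟨fun _ => 0, ⟨rfl, ?_, ?_, ?_, ?_, ?_, ?_, ?_⟩, fun i nd hnd => ?_⟩ <;>
      simp_all [sem, hwq, tsq]
  step := by
    rintro c d a c' ⟨τ, hm, hp⟩ ht
    cases ht with
    | call i m a hc =>
      have hi := hp i
      rw [hc] at hi
      cases hd : d.proc i with
      | some b => rw [hd] at hi; exact hi.elim
      | none =>
        rw [hd] at hi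
        refine ⟨[.call i m a], _, .cons (.call d i m a hd) (.nil _), rfl,
          rel_of_frame hp hm (.refl i _ _) ?_⟩
        cases m with
        | enq => exact ⟨rfl, hi⟩
        | deq => exact ⟨hi, trivial⟩
    | internal i m s s' σ' hc hs =>
      have hi := hp i
      rw [hc] at hi
      rcases hd : d.proc i with _ | ⟨m', t⟩
      · rw [hd] at hi; cases m <;> exact hi.elim
      · rw [hd] at hi
        cases m <;> cases m'
        · obtain ⟨μ', t', τ', hpath, hm', hf, hr⟩ := enqStep hm hi hs
          obtain ⟨l, hl, hh⟩ := path_of_localSteps d.proc hd hpath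
          exact ⟨l, _, hl, hh, rel_of_frame hp hm' hf hr⟩
        · exact hi.elim
        · exact hi.elim
        · obtain ⟨μ', t', hpath, hm', hf, hr⟩ := deqStep hm hi.1 hi.2 hs
          obtain ⟨l, hl, hh⟩ := path_of_localSteps d.proc hd hpath
          exact ⟨l, _, hl, hh, rel_of_frame hp hm' hf hr⟩
    | ret i m s b hc hb =>
      have hi := hp i
      rw [hc] at hi
      rcases hd : d.proc i with _ | ⟨m', t⟩
      · rw [hd] at hi; cases m <;> exact hi.elim
      -- The return value is transported along the equality of the methods, which is itself part of
      -- what has to be proved.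
      · have hnt : m = m' ∧ NoTop (d.mem.pool i) ∧
            ∀ e : m = m', tsq.result n m' t (e ▸ b) := by
          rw [hd] at hi
          cases m <;> cases m'
          · change s = HWQ.EnqLoc.e3 at hb
            subst hb
            cases t with
            | n4 => exact ⟨rfl, hi, fun _ => rfl⟩
            | _ => exact hi.elim
          · exact hi.elim
          · exact hi.elim
          · change s = HWQ.DeqLoc.d4 b at hb
            subst hb
            cases t with
            | r5 x =>
              obtain ⟨h1, h2⟩ := hi
              exact ⟨rfl, h1, fun _ => congrArg TSQ.DeqLoc.r5 h2.symm⟩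
            | _ => exact hi.2.elim
        obtain ⟨rfl, hnt, hres⟩ := hnt
        exact ⟨[.ret i m b], _, .cons (.ret d i m t b hd (hres rfl)) (.nil _), rfl,
          rel_of_frame hp hm (.refl i _ _) hnt⟩

end HWQSimulation

end ConcObj

theorem theorem5 (n : ℕ) :
    ConcObj.ForwardSimulated (ConcObj.sem ConcObj.hwq n) (ConcObj.sem ConcObj.tsq n) :=
  ⟨_, ConcObj.HWQSimulation.isForwardSimulation n⟩
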